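/- For a permutation $\pi$ of $\{1,\dots,n\}$ let $d(\pi)=|\{1\le i\le n-1 : \pi(i)>\pi(i+1)\}|$ be its descent number. For a partition $\lambda\vdash n$ let $\mathcal C_\lambda\subseteq S_n$ be the conjugacy class of the permutations with cycle lengths $\lambda$ (fixed points counted as cycles of length $1$), let $m_1(\lambda)$ be the number of parts of $\lambda$ equal to $1$, and let $D_\lambda=d(\pi)$ for $\pi$ uniformly distributed on $\mathcal C_\lambda$. Lemma. Let $\lambda$ vary over partitions of integers $n$ in such a way that $n\to\infty$ and $m_1(\lambda)/n\to\alpha$. Then the asymptotic variance of $D_\lambda$ is $(1-4\alpha^3+3\alpha^4)\,\frac{n}{12}$; that is, \[ \operatorname{Var}(D_\lambda) = \left(1-4\alpha^3+3\alpha^4\right)\frac{n}{12} + o(n), \qquad\text{equivalently}\qquad \frac{\operatorname{Var}(D_\lambda)}{n}\longrightarrow\frac{1-4\alpha^3+3\alpha^4}{12}, \] and in particular, if $\alpha<1$, $\operatorname{Var}(D_\lambda)\sim(1-4\alpha^3+3\alpha^4)\,\frac{n}{12}$. -/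

import Mathlib

/-- The descent set of a permutation `π` of `{0, …, n - 1}`: the positions `i` that have a
successor `i + 1 < n` and satisfy `π (i + 1) < π i`. -/
def descentSet {n : ℕ} (π : Equiv.Perm (Fin n)) : Finset (Fin n) :=
  {i | ∃ h : (i : ℕ) + 1 < n, π ⟨i + 1, h⟩ < π i}

/-- The descent number `d(π)`. -/
def descentNumber {n : ℕ} (π : Equiv.Perm (Fin n)) : ℕ :=
  (descentSet π).card

/-- The conjugacy class `C_p` of `S_n`: the permutations whose cycle lengths, fixed points
counted as cycles of length one, are the parts of `p`. -/
def cycleClass {n : ℕ} (p : n.Partition) : Finset (Equiv.Perm (Fin n)) :=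
  {π | π.partition.parts = p.parts}

/-- The number `m_i` of parts of `p` equal to `i`. -/
def partMult {n : ℕ} (p : n.Partition) (i : ℕ) : ℕ :=
  p.parts.count i

/-- The variance of `d(π)`, where `π` is uniformly distributed on `C_p`. The finite set `S_n`
carries the discrete σ-algebra. -/
noncomputable def descentVariance {n : ℕ} (p : n.Partition) : ℝ :=
  letI : MeasurableSpace (Equiv.Perm (Fin n)) := ⊤
  ProbabilityTheory.variance (fun π : Equiv.Perm (Fin n) => (descentNumber π : ℝ))
    (ProbabilityTheory.uniformOn (cycleClass p : Set (Equiv.Perm (Fin n))))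
/-!
Write `2 d(π) - (n - 1)` as the sum over adjacent positions `a`, `b = a + 1` of the sign which is
`1` at a descent and `-1` otherwise. Conjugating `π` by the transposition of `a` and `b` flips this
sign unless `π` fixes or exchanges the two points, so for a conjugation-invariant random `π` its
average is `P(a ↔ b) - P(a and b fixed)`. Let `r_k` be the probability that `k` given points are
fixed, which depends only on `n` and the number of fixed points. Then

* for disjoint pairs the trick applies to each pair up to an event of probability `O(1 / n²)`, so
  the signs have covariance `r₄ - r₂² + O(1 / n²)`;
* for consecutive pairs the product of the signs `s(a,b)` and `s(b,c)` equals
  `-1 + s(a,c) (s(a,b) + s(b,c))`, and conjugation by either transposition relates the means of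
  these three products up to `O(1 / n)`, which gives the covariance
  `-1/3 + 4/3 r₃ - r₂² + O(1 / n)`.

Summing up, `4 Var d(π)` is an explicit expression in `n` and `r₂, r₃, r₄` up to `O(1)`. With
`r_k → α ^ k` and `n (r₄ - r₂²) → -4 α³ + 4 α⁴` its quotient by `n` tends to
`(1 - α⁴) + 2 (-1/3 + 4/3 α³ - α⁴) + (-4 α³ + 4 α⁴) = (1 - 4 α³ + 3 α⁴) / 3`.
-/

open Equiv Finset MeasureTheory ProbabilityTheory

/-! ### Conjugation-invariant random permutations -/

section ConjInvariant

lemma covariance_indicator_one {Ω : Type*} [MeasurableSpace Ω] {P : Measure Ω}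
    [IsProbabilityMeasure P] {A B : Set Ω} (hA : MeasurableSet A) (hB : MeasurableSet B) :
    cov[A.indicator 1, B.indicator 1; P] = P.real (A ∩ B) - P.real A * P.real B := by
  have hmem {C : Set Ω} (hC : MeasurableSet C) : MemLp (C.indicator (1 : Ω → ℝ)) 2 P :=
    (memLp_const 1).indicator hC
  rw [covariance_eq_sub (hmem hA) (hmem hB), ← Set.inter_indicator_one,
    integral_indicator_one (hA.inter hB), integral_indicator_one hA, integral_indicator_one hB]

lemma three_lt_card_of_ne {α : Type*} [Fintype α] {a b c d : α} (hab : a ≠ b) (hca : c ≠ a)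
    (hcb : c ≠ b) (hda : d ≠ a) (hdb : d ≠ b) (hdc : d ≠ c) : (3 : ℝ) < Fintype.card α := by
  have hnodup : [a, b, c, d].Nodup := by simp [*, Ne.symm]
  exact_mod_cast hnodup.length_le_card

variable {α : Type*}

/-- An event about a random permutation that involves only the points of `S`, in the sense that
relabelling the points outside `S` does not affect it. -/
def IsInvariantOff (S : Finset α) (A : Set (Perm α)) : Prop :=
  ∀ σ : Perm α, (∀ s ∈ S, σ s = s) → ∀ π, σ * π * σ⁻¹ ∈ A ↔ π ∈ A

lemma isInvariantOff_univ (S : Finset α) : IsInvariantOff S Set.univ := fun _ _ _ => Iff.rfl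

lemma isInvariantOff_apply_eq {S : Finset α} {a b : α} (ha : a ∈ S) (hb : b ∈ S) :
    IsInvariantOff S {π | π a = b} := fun σ hσ π => by
  have hσa : σ⁻¹ a = a := by rw [Perm.inv_eq_iff_eq, hσ a ha]
  have hσb : σ⁻¹ b = b := by rw [Perm.inv_eq_iff_eq, hσ b hb]
  rw [Set.mem_ofPred_eq, Set.mem_ofPred_eq, Perm.mul_apply, Perm.mul_apply, hσa,
    ← Perm.eq_inv_iff_eq, hσb]

lemma IsInvariantOff.inter {S : Finset α} {A B : Set (Perm α)} (hA : IsInvariantOff S A)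
    (hB : IsInvariantOff S B) : IsInvariantOff S (A ∩ B) :=
  fun σ hσ π => and_congr (hA σ hσ π) (hB σ hσ π)

/-- The event that every point of `T` is fixed. -/
def fixing (T : Finset α) : Set (Perm α) := {π | ∀ x ∈ T, π x = x}

/-- The event that `a` and `b` are exchanged. -/
def swapping (a b : α) : Set (Perm α) := {π | π a = b ∧ π b = a}

lemma isInvariantOff_swapping [DecidableEq α] (a b : α) :
    IsInvariantOff {a, b} (swapping a b) :=
  (isInvariantOff_apply_eq (by simp) (by simp)).inter
    (isInvariantOff_apply_eq (by simp) (by simp))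

lemma isInvariantOff_fixing (T : Finset α) : IsInvariantOff T (fixing T) := fun σ hσ π =>
  forall₂_congr fun _ hx => isInvariantOff_apply_eq hx hx σ hσ π

lemma conj_mem_fixing_map_iff (σ π : Perm α) (T : Finset α) :
    σ * π * σ⁻¹ ∈ fixing (T.map σ.toEmbedding) ↔ π ∈ fixing T := by
  simp only [fixing, Set.mem_ofPred_eq, forall_mem_map]
  simp

lemma exists_perm_map_eq_of_disjoint [Finite α] {S T T' : Finset α} (hT : Disjoint S T)
    (hT' : Disjoint S T') (hcard : #T = #T') :
    ∃ σ : Perm α, (∀ s ∈ S, σ s = s) ∧ T.map σ.toEmbedding = T' := by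
  classical
  let e : {x // x ∈ S ∪ T} ≃ {x // x ∈ S ∪ T'} :=
    (Equiv.Finset.union S T hT).symm.trans
      (((Equiv.refl S).sumCongr (Finset.equivOfCardEq hcard)).trans (Equiv.Finset.union S T' hT'))
  refine ⟨e.extendSubtype, fun s hs => ?_,
    eq_of_subset_of_card_le (fun y hy => ?_) (by simp [hcard])⟩
  · rw [extendSubtype_apply_of_mem e s (mem_union_left _ hs)]
    simp [e, Equiv.Finset.union_symm_left hT hs]
  · obtain ⟨x, hx, rfl⟩ := mem_map.1 hy
    change e.extendSubtype x ∈ T'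
    rw [extendSubtype_apply_of_mem e x (mem_union_right _ hx)]
    simp [e, Equiv.Finset.union_symm_right hT hx]

variable [MeasurableSpace (Perm α)] [DiscreteMeasurableSpace (Perm α)]
  {μ : Measure (Perm α)} [SMulInvariantMeasure (ConjAct (Perm α)) (Perm α) μ]

lemma integral_comp_conj (σ : Perm α) (f : Perm α → ℝ) :
    ∫ π, f (σ * π * σ⁻¹) ∂μ = ∫ π, f π ∂μ :=
  have : MeasurableConstSMul (ConjAct (Perm α)) (Perm α) := ⟨fun _ => .of_discrete⟩
  integral_smul_eq_self f (g := ConjAct.toConjAct σ)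

lemma measureReal_eq_of_conj_mem_iff {A B : Set (Perm α)} (σ : Perm α)
    (h : ∀ π, σ * π * σ⁻¹ ∈ B ↔ π ∈ A) : μ.real A = μ.real B := by
  have hAB : A = (fun π => ConjAct.toConjAct σ • π) ⁻¹' B := Set.ext fun π => (h π).symm
  rw [measureReal_def, measureReal_def, hAB,
    SMulInvariantMeasure.measure_preimage_smul _ (.of_discrete : MeasurableSet B)]

lemma card_mul_measureReal_eq_integral_card [Finite α] [IsFiniteMeasure μ] {β : Type*}
    {O : Finset β} (E : β → Set (Perm α)) [∀ π, DecidablePred fun y => π ∈ E y] {x : β}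
    (hO : ∀ y ∈ O, ∃ σ : Perm α, ∀ π, σ * π * σ⁻¹ ∈ E y ↔ π ∈ E x) :
    #O * μ.real (E x) = ∫ π, (#{y ∈ O | π ∈ E y} : ℝ) ∂μ := by
  have hE : ∀ y ∈ O, μ.real (E y) = μ.real (E x) := fun y hy =>
    let ⟨σ, hσ⟩ := hO y hy
    (measureReal_eq_of_conj_mem_iff σ hσ).symm
  calc (#O : ℝ) * μ.real (E x) = ∑ y ∈ O, μ.real (E y) := by
        rw [sum_congr rfl hE, sum_const, nsmul_eq_mul]
    _ = ∑ y ∈ O, ∫ π, (E y).indicator 1 π ∂μ := by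
        simp only [integral_indicator_one MeasurableSet.of_discrete]
    _ = ∫ π, (#{y ∈ O | π ∈ E y} : ℝ) ∂μ := by
        rw [← integral_finsetSum _ fun _ _ => .of_finite]
        classical
        simp only [Set.indicator_apply, Pi.one_apply, sum_boole]

variable [Fintype α]

lemma descFactorial_mul_measureReal_inter_fixing [DecidableEq α] [IsFiniteMeasure μ] {F : ℕ}
    (hF : ∀ᵐ π ∂μ, #π.supportᶜ = F) {S T : Finset α} (hST : Disjoint S T) {A : Set (Perm α)}
    (hA : IsInvariantOff S A) (hAS : ∀ π ∈ A, ∀ s ∈ S, π s ≠ s) :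
    (Fintype.card α - #S).descFactorial (#T) * μ.real (A ∩ fixing T)
      = F.descFactorial (#T) * μ.real A := by
  classical
  have hcard : #(powersetCard (#T) Sᶜ) = (Fintype.card α - #S).choose (#T) := by
    rw [card_powersetCard, card_compl]
  have hpoint : ∀ᵐ π ∂μ, (#{T' ∈ powersetCard (#T) Sᶜ | π ∈ A ∩ fixing T'} : ℝ)
      = F.choose (#T) * A.indicator 1 π := by
    filter_upwards [hF] with π hπ
    by_cases hπA : π ∈ A
    · have hset : {T' ∈ powersetCard (#T) Sᶜ | π ∈ A ∩ fixing T'}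
          = powersetCard (#T) π.supportᶜ := by
        ext T'
        simp only [mem_filter, mem_powersetCard, subset_iff, mem_compl, Perm.notMem_support,
          Set.mem_inter_iff, hπA, true_and, fixing, Set.mem_ofPred_eq]
        have := hAS π hπA
        grind
      rw [hset, card_powersetCard, hπ]
      simp [hπA]
    · simp [hπA]
  have havg := card_mul_measureReal_eq_integral_card (μ := μ) (O := powersetCard (#T) Sᶜ)
    (fun T' => A ∩ fixing T') (x := T) fun T' hT' => by
      obtain ⟨hsub, hcard'⟩ := mem_powersetCard.1 hT'
      obtain ⟨σ, hσS, rfl⟩ := exists_perm_map_eq_of_disjoint hST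
        (disjoint_left.2 fun s hs hs' => mem_compl.1 (hsub hs') hs) hcard'.symm
      exact ⟨σ, fun π => and_congr (hA σ hσS π) (conj_mem_fixing_map_iff σ π T)⟩
  rw [hcard, integral_congr_ae hpoint, integral_const_mul,
    integral_indicator_one .of_discrete] at havg
  simp only [Nat.descFactorial_eq_factorial_mul_choose, Nat.cast_mul, mul_assoc, havg]

lemma card_sub_mul_measureReal_inter_apply_eq_le [IsFiniteMeasure μ] {S : Finset α}
    {A : Set (Perm α)} (hA : IsInvariantOff S A) {a b : α} (ha : a ∈ S) (hb : b ∉ S) :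
    ((Fintype.card α : ℝ) - #S) * μ.real (A ∩ {π | π a = b}) ≤ μ.real A := by
  classical
  have hcard : (#Sᶜ : ℝ) = Fintype.card α - #S := by
    rw [card_compl, Nat.cast_sub (card_le_univ S)]
  have hpoint (π : Perm α) : (#{y ∈ Sᶜ | π ∈ A ∩ {π | π a = y}} : ℝ) ≤ A.indicator 1 π := by
    by_cases hπA : π ∈ A
    · have : #{y ∈ Sᶜ | π ∈ A ∩ {π | π a = y}} ≤ 1 := card_le_one.2 <| by simp_all
      simpa [hπA] using this
    · simp [hπA]
  rw [← hcard, card_mul_measureReal_eq_integral_card (fun y => A ∩ {π | π a = y}) fun y hy => ?_,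
    ← integral_indicator_one .of_discrete]
  · exact integral_mono .of_finite .of_finite fun π => hpoint π
  · have hσ : ∀ s ∈ S, swap b y s = s := fun s hs =>
      swap_apply_of_ne_of_ne (ne_of_mem_of_not_mem hs hb)
        (ne_of_mem_of_not_mem hs (mem_compl.1 hy))
    refine ⟨swap b y, fun π => and_congr (hA _ hσ π) ?_⟩
    simp [hσ a ha, swap_apply_eq_iff]

variable [IsProbabilityMeasure μ]

lemma measureReal_apply_eq_le {a b : α} (hab : a ≠ b) :
    μ.real {π | π a = b} ≤ 1 / ((Fintype.card α : ℝ) - 1) := by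
  have hcard : (1 : ℝ) < Fintype.card α := by
    exact_mod_cast Fintype.one_lt_card_iff.2 ⟨a, b, hab⟩
  have h := card_sub_mul_measureReal_inter_apply_eq_le (μ := μ) (isInvariantOff_univ {a})
    (mem_singleton_self a) (by simpa using hab.symm)
  rw [Set.univ_inter, card_singleton, Nat.cast_one, probReal_univ] at h
  rwa [le_div_iff₀' (by linarith)]

lemma measureReal_apply_eq_inter_apply_eq_le {a b c d : α} (hab : a ≠ b) (hca : c ≠ a)
    (hcb : c ≠ b) (hda : d ≠ a) (hdb : d ≠ b) (hdc : d ≠ c) :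
    μ.real ({π | π a = b} ∩ {π | π c = d})
      ≤ 1 / (((Fintype.card α : ℝ) - 1) * (Fintype.card α - 3)) := by
  classical
  have hcard3 : #{a, b, c} = 3 := card_eq_three.2 ⟨a, b, c, hab, hca.symm, hcb.symm, rfl⟩
  have hcard := three_lt_card_of_ne hab hca hcb hda hdb hdc
  have h := card_sub_mul_measureReal_inter_apply_eq_le (μ := μ) (S := {a, b, c})
    (isInvariantOff_apply_eq (a := a) (b := b) (by simp) (by simp)) (a := c) (b := d) (by simp)
    (by simp [hda, hdb, hdc])
  rw [hcard3, Nat.cast_ofNat] at h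
  rw [← div_div, le_div_iff₀' (by linarith)]
  exact h.trans (measureReal_apply_eq_le hab)

/-- The probability `F (F - 1) ⋯ (F - k + 1) / (n (n - 1) ⋯ (n - k + 1))` that a
conjugation-invariant random permutation of `n` points with `F` fixed points fixes `k` given
points. -/
noncomputable def fallingRatio (F n k : ℕ) : ℝ := F.descFactorial k / n.descFactorial k

lemma measureReal_fixing [DecidableEq α] {F : ℕ} (hF : ∀ᵐ π ∂μ, #π.supportᶜ = F) (T : Finset α) :
    μ.real (fixing T) = fallingRatio F (Fintype.card α) (#T) := by
  have h := descFactorial_mul_measureReal_inter_fixing hF (disjoint_empty_left T)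
    (isInvariantOff_univ ∅) (by simp)
  rw [card_empty, Nat.sub_zero, Set.univ_inter, probReal_univ, mul_one] at h
  rw [fallingRatio, eq_div_iff, mul_comm, h]
  exact_mod_cast (Nat.descFactorial_pos.2 (card_le_univ T)).ne'

lemma measureReal_swapping_le {a b : α} (hab : a ≠ b) :
    μ.real (swapping a b) ≤ 1 / ((Fintype.card α : ℝ) - 1) :=
  (measureReal_mono fun _ hπ => hπ.1).trans (measureReal_apply_eq_le hab)

variable {a b c d : α}

lemma abs_covariance_swapping_swapping_le (hab : a ≠ b) (hca : c ≠ a) (hcb : c ≠ b) (hda : d ≠ a)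
    (hdb : d ≠ b) (hdc : d ≠ c) :
    |cov[(swapping a b).indicator 1, (swapping c d).indicator 1; μ]|
      ≤ 1 / (((Fintype.card α : ℝ) - 1) * (Fintype.card α - 3)) := by
  have hcard := three_lt_card_of_ne hab hca hcb hda hdb hdc
  rw [covariance_indicator_one .of_discrete .of_discrete]
  refine abs_sub_le_of_nonneg_of_le measureReal_nonneg ?_ (by positivity) ?_
  · exact (measureReal_mono (Set.inter_subset_inter (fun _ hπ => hπ.1) fun _ hπ => hπ.1)).trans
      (measureReal_apply_eq_inter_apply_eq_le hab hca hcb hda hdb hdc)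
  · calc μ.real (swapping a b) * μ.real (swapping c d)
        ≤ 1 / ((Fintype.card α : ℝ) - 1) * (1 / ((Fintype.card α : ℝ) - 1)) :=
          mul_le_mul (measureReal_swapping_le hab) (measureReal_swapping_le hdc.symm)
            measureReal_nonneg (one_div_nonneg.2 (by linarith))
      _ ≤ 1 / (((Fintype.card α : ℝ) - 1) * (Fintype.card α - 3)) := by
          rw [one_div_mul_one_div]
          exact one_div_le_one_div_of_le (by nlinarith) (by nlinarith)

lemma measureReal_swapping_inter_fixing [DecidableEq α] {F : ℕ} (hF : ∀ᵐ π ∂μ, #π.supportᶜ = F)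
    (hab : a ≠ b) (hca : c ≠ a) (hcb : c ≠ b) (hda : d ≠ a) (hdb : d ≠ b) (hdc : d ≠ c) :
    ((Fintype.card α : ℝ) - 2) * (Fintype.card α - 3) * μ.real (swapping a b ∩ fixing {c, d})
      = Fintype.card α * (Fintype.card α - 1) * μ.real (swapping a b) * μ.real (fixing {c, d}) := by
  have hcard : 3 < Fintype.card α := by
    exact_mod_cast three_lt_card_of_ne hab hca hcb hda hdb hdc
  have h := descFactorial_mul_measureReal_inter_fixing hF (S := {a, b}) (T := {c, d})
    (by simp [*, Ne.symm]) (isInvariantOff_swapping a b)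
    (fun π hπ => by simp [hπ.1, hπ.2, hab, hab.symm])
  have hN : (Fintype.card α : ℝ) * (Fintype.card α - 1) ≠ 0 := by
    rw [← Nat.cast_descFactorial_two]
    exact_mod_cast (Nat.descFactorial_pos.2 (by omega)).ne'
  rw [card_pair hab, card_pair hdc.symm, Nat.cast_descFactorial_two,
    Nat.cast_sub (by omega)] at h
  rw [measureReal_fixing hF, card_pair hdc.symm, fallingRatio, Nat.cast_descFactorial_two ℝ
    (Fintype.card α)]
  rw [Nat.cast_ofNat] at h
  linear_combination h - μ.real (swapping a b) * mul_div_cancel₀ (F.descFactorial 2 : ℝ) hN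

lemma abs_covariance_swapping_fixing_le [DecidableEq α] {F : ℕ} (hF : ∀ᵐ π ∂μ, #π.supportᶜ = F)
    (hab : a ≠ b) (hca : c ≠ a) (hcb : c ≠ b) (hda : d ≠ a) (hdb : d ≠ b) (hdc : d ≠ c) :
    |cov[(swapping a b).indicator 1, (fixing {c, d}).indicator 1; μ]|
      ≤ 5 / (((Fintype.card α : ℝ) - 1) * (Fintype.card α - 3)) := by
  have hcard := three_lt_card_of_ne hab hca hcb hda hdb hdc
  have hcard4 : (4 : ℝ) ≤ Fintype.card α := by exact_mod_cast hcard
  set N : ℝ := (Fintype.card α : ℝ)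
  have hcov : μ.real (swapping a b ∩ fixing {c, d}) - μ.real (swapping a b) * μ.real (fixing {c, d})
      = μ.real (swapping a b) * μ.real (fixing {c, d}) * ((4 * N - 6) / ((N - 2) * (N - 3))) := by
    have hN2 : N - 2 ≠ 0 := by linarith
    have hN3 : N - 3 ≠ 0 := by linarith
    field_simp
    linear_combination measureReal_swapping_inter_fixing hF hab hca hcb hda hdb hdc
  have hN : (4 * N - 6) / ((N - 2) * (N - 3)) ≤ 5 / (N - 3) := by
    rw [← div_div]
    gcongr
    rw [div_le_iff₀] <;> linarith
  have hN0 : 0 ≤ (4 * N - 6) / ((N - 2) * (N - 3)) :=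
    div_nonneg (by linarith) (mul_nonneg (by linarith) (by linarith))
  rw [covariance_indicator_one .of_discrete .of_discrete, hcov, abs_of_nonneg (by positivity)]
  have hswap : μ.real (swapping a b) ≤ 1 / (N - 1) := measureReal_swapping_le hab
  have hfix : μ.real (fixing {c, d}) ≤ 1 := measureReal_le_one
  calc _ ≤ 1 / (N - 1) * 1 * (5 / (N - 3)) := by
        have := measureReal_nonneg.trans hswap
        gcongr
    _ = _ := by rw [mul_one, div_mul_div_comm, one_mul]

end ConjInvariant

/-! ### Descent signs -/

section DescSign

variable {α : Type*} [LinearOrder α] {a b c d : α}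

/-- The sign of the pair of positions `a`, `b`: for `a < b` it is `1` if `π` inverts the pair and
`-1` if it does not. -/
noncomputable def descSign (a b : α) (π : Perm α) : ℝ := if π b < π a then 1 else -1

/-- The average of `descSign a b` over the conjugates of a permutation by `1` and `swap a b`. -/
noncomputable def pairSign (a b : α) (π : Perm α) : ℝ :=
  (swapping a b).indicator 1 π - (fixing {a, b}).indicator 1 π

lemma abs_descSign (a b : α) (π : Perm α) : |descSign a b π| = 1 := by
  unfold descSign
  split_ifs <;> simp

lemma descSign_comm (hab : a ≠ b) : descSign b a = -descSign a b := by
  ext π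
  have hπ : π a ≠ π b := π.injective.ne hab
  unfold descSign
  simp only [Pi.neg_apply]
  grind

-- Not all three of `a → b`, `b → c`, `c → a` can be descents, and not all three ascents.
lemma descSign_mul_descSign (a b c : α) (π : Perm α) :
    descSign a b π * descSign b c π = -1 + descSign a c π * (descSign a b π + descSign b c π) := by
  unfold descSign
  split_ifs <;> first | (exfalso; order) | norm_num

lemma swap_lt_swap_iff_of_covBy (h : a ⋖ b) {x y : α} (hab : ¬(x = a ∧ y = b))
    (hba : ¬(x = b ∧ y = a)) : swap a b x < swap a b y ↔ x < y := by
  have hlt := h.lt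
  have hbtw : ∀ z, a < z → ¬z < b := fun z haz => h.2 haz
  have hx := hbtw x
  have hy := hbtw y
  simp only [swap_apply_def]
  grind

lemma descSign_conj_swap (h : a ⋖ b) {x y : α} {π : Perm α}
    (hab : ¬(π (swap a b x) = a ∧ π (swap a b y) = b))
    (hba : ¬(π (swap a b x) = b ∧ π (swap a b y) = a)) :
    descSign x y (swap a b * π * (swap a b)⁻¹) = descSign (swap a b x) (swap a b y) π := by
  unfold descSign
  refine if_congr ?_ rfl rfl
  rw [swap_inv, Perm.mul_apply, Perm.mul_apply, Perm.mul_apply, Perm.mul_apply]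
  exact swap_lt_swap_iff_of_covBy h (fun hyx => hba hyx.symm) fun hyx => hab hyx.symm

lemma descSign_add_descSign_conj_swap (h : a ⋖ b) (π : Perm α) :
    descSign a b π + descSign a b (swap a b * π * (swap a b)⁻¹) = 2 * pairSign a b π := by
  have hne := h.ne
  have hnlt := h.lt.not_gt
  by_cases hfix : π a = a ∧ π b = b
  · simp only [descSign, hfix, hnlt, ↓reduceIte, swap_inv, Perm.coe_mul, Function.comp_apply,
      swap_apply_right, swap_apply_left, pairSign, swapping, Set.mem_ofPred_eq, hne, false_and,
      not_false_eq_true, Set.indicator_of_notMem, fixing, mem_insert, mem_singleton,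
      forall_eq_or_imp, forall_eq, and_self, Set.indicator_of_mem, Pi.one_apply]
    norm_num
  by_cases hswap : π a = b ∧ π b = a
  · simp only [descSign, hswap, h.lt, ↓reduceIte, swap_inv, Perm.coe_mul, Function.comp_apply,
      swap_apply_right, swap_apply_left, pairSign, swapping, Set.mem_ofPred_eq, and_self,
      Set.indicator_of_mem, Pi.one_apply, fixing, mem_insert, mem_singleton, forall_eq_or_imp,
      forall_eq, hne.symm, hne, not_false_eq_true, Set.indicator_of_notMem]
    norm_num
  rw [descSign_conj_swap h (by simpa [and_comm] using hswap) (by simpa [and_comm] using hfix),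
    swap_apply_left, swap_apply_right, descSign_comm hne]
  simp [pairSign, swapping, fixing, hfix, hswap]

lemma pairSign_conj {σ : Perm α} (ha : σ a = a) (hb : σ b = b) (π : Perm α) :
    pairSign a b (σ * π * σ⁻¹) = pairSign a b π := by
  have hσ : ∀ s ∈ ({a, b} : Finset α), σ s = s := by simp [ha, hb]
  classical
  simp only [pairSign, Set.indicator_apply, Pi.one_apply, isInvariantOff_swapping a b σ hσ π,
    isInvariantOff_fixing {a, b} σ hσ π]

lemma descSign_eq_of_mem_fixing (h : a ⋖ b) (hca : c ≠ a) {π : Perm α}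
    (hπ : π ∈ fixing {a, b}) : descSign a c π = descSign b c π := by
  have ha : π a = a := hπ a (by simp)
  have hb : π b = b := hπ b (by simp)
  have hπca : π c ≠ a := fun hc => hca (π.injective (hc.trans ha.symm))
  have hlt : π c < a ↔ π c < b :=
    ⟨fun hc => hc.trans h.lt, fun hc => (h.le_of_lt hc).lt_of_ne hπca⟩
  simp only [descSign, ha, hb, hlt]

lemma indicator_fixing_descSign_add_conj_swap (hac : a < c) (hbc : b ⋖ c) (hab : a ≠ b)
    (π : Perm α) : (fixing {a, b}).indicator (descSign b c) π
      + (fixing {b, c}).indicator (descSign a c) (swap a c * π * (swap a c)⁻¹)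
        = -2 * (fixing {a, b, c}).indicator 1 π := by
  have hmem : swap a c * π * (swap a c)⁻¹ ∈ fixing {b, c} ↔ π ∈ fixing {a, b} := by
    have hmap : ({a, b} : Finset α).map (swap a c).toEmbedding = {b, c} := by
      simp [map_insert, swap_apply_of_ne_of_ne hab.symm hbc.ne, pair_comm]
    rw [← hmap, conj_mem_fixing_map_iff]
  by_cases hπ : π ∈ fixing {a, b}
  · have ha : π a = a := hπ a (by simp)
    have hb : π b = b := hπ b (by simp)
    rw [Set.indicator_of_mem hπ, Set.indicator_of_mem (hmem.2 hπ)]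
    by_cases hc : π c = c
    · have hmem3 : π ∈ fixing {a, b, c} := by simp [fixing, ha, hb, hc]
      simp only [descSign, hc, hb, hbc.lt.not_gt, ↓reduceIte, swap_inv, Perm.coe_mul,
        Function.comp_apply, swap_apply_right, ha, swap_apply_left, hac.not_gt, hmem3,
        Set.indicator_of_mem, Pi.one_apply]
      norm_num
    · have hmem3 : π ∉ fixing {a, b, c} := fun h => hc (h c (by simp))
      have hca : π c ≠ a := fun h => hac.ne' (π.injective (h.trans ha.symm))
      have hcb : π c ≠ b := fun h => hbc.ne' (π.injective (h.trans hb.symm))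
      have hlt : c < π c ↔ ¬π c < b := by
        rw [not_lt, hcb.symm.le_iff_lt, hbc.lt_iff_le_right, (Ne.symm hc).le_iff_lt]
      simp only [descSign, hb, swap_inv, Perm.coe_mul, Function.comp_apply, swap_apply_right, ha,
        swap_apply_left, swap_apply_of_ne_of_ne hca hc, hlt, hmem3, not_false_eq_true,
        Set.indicator_of_notMem, mul_zero]
      grind
  · have hmem3 : π ∉ fixing {a, b, c} := fun h => hπ fun x hx => h x (by grind)
    rw [Set.indicator_of_notMem hπ, Set.indicator_of_notMem (mt hmem.1 hπ),
      Set.indicator_of_notMem hmem3, add_zero, mul_zero]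

variable [Finite α] [MeasurableSpace (Perm α)] [DiscreteMeasurableSpace (Perm α)]
  {μ : Measure (Perm α)} [IsFiniteMeasure μ]

lemma integral_mul_pairSign (a b : α) (Y : Perm α → ℝ) :
    ∫ π, Y π * pairSign a b π ∂μ
      = ∫ π in swapping a b, Y π ∂μ - ∫ π in fixing {a, b}, Y π ∂μ := by
  rw [← integral_indicator .of_discrete, ← integral_indicator .of_discrete,
    ← integral_sub .of_finite .of_finite]
  simp only [pairSign, mul_sub, ← Set.indicator_mul_right, Pi.one_apply, mul_one]

variable [SMulInvariantMeasure (ConjAct (Perm α)) (Perm α) μ]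

lemma abs_integral_mul_descSign_sub_le (h : a ⋖ b) {Y : Perm α → ℝ} {M : ℝ}
    (hY : ∀ π, |Y π| ≤ M) {B : Set (Perm α)}
    (hB : ∀ π ∉ B, Y (swap a b * π * (swap a b)⁻¹) = Y π) :
    |∫ π, Y π * descSign a b π ∂μ - ∫ π, Y π * pairSign a b π ∂μ| ≤ M * μ.real B := by
  set conj : Perm α → Perm α := fun π => swap a b * π * (swap a b)⁻¹
  have hsplit : ∫ π, Y π * descSign a b π ∂μ - ∫ π, Y π * pairSign a b π ∂μ
      = ∫ π, (Y (conj π) - Y π) * descSign a b (conj π) / 2 ∂μ := by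
    have hconj : ∫ π, Y (conj π) * descSign a b (conj π) ∂μ = ∫ π, Y π * descSign a b π ∂μ :=
      integral_comp_conj (swap a b) fun π => Y π * descSign a b π
    have hpoint (π : Perm α) : (Y (conj π) - Y π) * descSign a b (conj π) / 2
        = (Y π * descSign a b π + Y (conj π) * descSign a b (conj π)) / 2
          - Y π * pairSign a b π := by
      linear_combination (-Y π / 2) * descSign_add_descSign_conj_swap h π
    simp_rw [hpoint]
    rw [integral_sub .of_finite .of_finite, integral_div, integral_add .of_finite .of_finite, hconj,
      add_self_div_two]
  have hbound (π : Perm α) :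
      |(Y (conj π) - Y π) * descSign a b (conj π) / 2| ≤ M * B.indicator 1 π := by
    by_cases hπ : π ∈ B
    · have := abs_le.1 (hY π)
      have := abs_le.1 (hY (conj π))
      rw [abs_div, abs_mul, abs_descSign, mul_one, abs_two, Set.indicator_of_mem hπ, Pi.one_apply,
        mul_one, div_le_iff₀ two_pos, abs_le]
      constructor <;> linarith
    · simp [show Y (conj π) = Y π from hB π hπ, hπ]
  calc |∫ π, Y π * descSign a b π ∂μ - ∫ π, Y π * pairSign a b π ∂μ|
      ≤ ∫ π, |(Y (conj π) - Y π) * descSign a b (conj π) / 2| ∂μ := by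
        rw [hsplit]
        exact abs_integral_le_integral_abs
    _ ≤ ∫ π, M * B.indicator 1 π ∂μ := integral_mono .of_finite .of_finite hbound
    _ = M * μ.real B := by rw [integral_const_mul, integral_indicator_one .of_discrete]

lemma integral_mul_descSign_eq (h : a ⋖ b) {Y : Perm α → ℝ}
    (hY : ∀ π, Y (swap a b * π * (swap a b)⁻¹) = Y π) :
    ∫ π, Y π * descSign a b π ∂μ = ∫ π, Y π * pairSign a b π ∂μ := by
  obtain ⟨M, hM⟩ := (Set.finite_range fun π => |Y π|).bddAbove
  have := abs_integral_mul_descSign_sub_le (μ := μ) h (fun π => hM ⟨π, rfl⟩) (B := ∅)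
    fun π _ => hY π
  rwa [measureReal_empty, mul_zero, abs_nonpos_iff, sub_eq_zero] at this

lemma integral_descSign_eq_integral_pairSign (h : a ⋖ b) :
    ∫ π, descSign a b π ∂μ = ∫ π, pairSign a b π ∂μ := by
  simpa only [one_mul] using integral_mul_descSign_eq (μ := μ) h (Y := fun _ => 1) fun _ => rfl

lemma integral_descSign (h : a ⋖ b) :
    ∫ π, descSign a b π ∂μ = μ.real (swapping a b) - μ.real (fixing {a, b}) := by
  rw [integral_descSign_eq_integral_pairSign h, ← integral_indicator_one .of_discrete,
    ← integral_indicator_one .of_discrete, ← integral_sub .of_finite .of_finite]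
  rfl

lemma setIntegral_fixing_descSign_add (hac : a < c) (hbc : b ⋖ c) (hab : a ≠ b) :
    ∫ π in fixing {a, b}, descSign b c π ∂μ + ∫ π in fixing {b, c}, descSign a c π ∂μ
      = -2 * μ.real (fixing {a, b, c}) := by
  rw [← integral_indicator .of_discrete, ← integral_indicator .of_discrete,
    ← integral_comp_conj (swap a c) ((fixing {b, c}).indicator _),
    ← integral_add .of_finite .of_finite, ← integral_indicator_one .of_discrete,
    ← integral_const_mul]
  exact integral_congr_ae (.of_forall (indicator_fixing_descSign_add_conj_swap hac hbc hab))

end DescSign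

/-! ### Correlations of descent signs -/

section Correlation

variable {α : Type*} [LinearOrder α] [Fintype α] {a b c d : α}
  [MeasurableSpace (Perm α)] [DiscreteMeasurableSpace (Perm α)]
  {μ : Measure (Perm α)} [SMulInvariantMeasure (ConjAct (Perm α)) (Perm α) μ]
  [IsProbabilityMeasure μ]

lemma abs_integral_descSign_mul_descSign_sub_le (hab : a ⋖ b) (hcd : c ⋖ d) (hca : c ≠ a)
    (hcb : c ≠ b) (hda : d ≠ a) (hdb : d ≠ b) :
    |∫ π, descSign a b π * descSign c d π ∂μ - ∫ π, pairSign a b π * pairSign c d π ∂μ|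
      ≤ 2 / (((Fintype.card α : ℝ) - 1) * (Fintype.card α - 3)) := by
  let B : Set (Perm α) := ({π | π c = a} ∩ {π | π d = b}) ∪ ({π | π c = b} ∩ {π | π d = a})
  have hμB : μ.real B ≤ 2 / (((Fintype.card α : ℝ) - 1) * (Fintype.card α - 3)) := by
    have h₁ := measureReal_apply_eq_inter_apply_eq_le (μ := μ) hca hcd.ne' hda hcb.symm hab.ne'
      hdb.symm
    have h₂ := measureReal_apply_eq_inter_apply_eq_le (μ := μ) hcb hcd.ne' hdb hca.symm hab.ne
      hda.symm
    calc μ.real B ≤ _ := measureReal_union_le _ _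
      _ ≤ _ := add_le_add h₁ h₂
      _ = _ := by ring
  have hdescSign := abs_integral_mul_descSign_sub_le (μ := μ) hab (Y := descSign c d)
    (fun π => (abs_descSign c d π).le) (B := B) fun π hπ => by
      have hc : swap a b c = c := swap_apply_of_ne_of_ne hca hcb
      have hd : swap a b d = d := swap_apply_of_ne_of_ne hda hdb
      rw [descSign_conj_swap hab, hc, hd] <;> rw [hc, hd] <;> exact fun hcd => hπ (by simp [B, hcd])
  have hpairSign := integral_mul_descSign_eq (μ := μ) hcd (Y := pairSign a b)
    (pairSign_conj (swap_apply_of_ne_of_ne hca.symm hda.symm)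
      (swap_apply_of_ne_of_ne hcb.symm hdb.symm))
  rw [← hpairSign]
  simp only [mul_comm (descSign a b _), mul_comm (pairSign a b _)]
  exact hdescSign.trans (by rwa [one_mul])

lemma abs_integral_add_mul_descSign_add_le (h : a ⋖ b) (hca : c ≠ a) (hcb : c ≠ b) :
    |∫ π, (descSign a c π + descSign b c π) * descSign a b π ∂μ
      + 2 * ∫ π in fixing {a, b}, descSign b c π ∂μ| ≤ 6 / ((Fintype.card α : ℝ) - 1) := by
  set Y : Perm α → ℝ := fun π => descSign a c π + descSign b c π
  have hY (π : Perm α) : |Y π| ≤ 2 :=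
    (abs_add_le _ _).trans (by rw [abs_descSign, abs_descSign, one_add_one_eq_two])
  have hdesc : |∫ π, Y π * descSign a b π ∂μ - ∫ π, Y π * pairSign a b π ∂μ|
      ≤ 4 / ((Fintype.card α : ℝ) - 1) := by
    have hc : swap a b c = c := swap_apply_of_ne_of_ne hca hcb
    refine (abs_integral_mul_descSign_sub_le h hY (B := {π | π c = a} ∪ {π | π c = b})
      fun π hπ => ?_).trans ?_
    · simp only [Y]
      rw [descSign_conj_swap h, descSign_conj_swap h, hc, swap_apply_left, swap_apply_right,
        add_comm] <;> rw [hc] <;> exact fun hcd => hπ (by simp [hcd])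
    · have hunion := measureReal_union_le (μ := μ) {π | π c = a} {π | π c = b}
      linear_combination 2 * hunion + 2 * measureReal_apply_eq_le (μ := μ) hca
        + 2 * measureReal_apply_eq_le (μ := μ) hcb
  have hswap : |∫ π in swapping a b, Y π ∂μ| ≤ 2 / ((Fintype.card α : ℝ) - 1) := by
    have hset : μ.real (swapping a b) ≤ μ.real {π | π a = b} :=
      measureReal_mono fun _ hπ => hπ.1
    refine (norm_setIntegral_le_of_norm_le_const (f := Y) (measure_lt_top μ _)
      fun π _ => hY π).trans ?_
    linear_combination 2 * hset + 2 * measureReal_apply_eq_le (μ := μ) h.ne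
  have hfix : ∫ π in fixing {a, b}, Y π ∂μ = 2 * ∫ π in fixing {a, b}, descSign b c π ∂μ := by
    rw [← integral_const_mul]
    refine setIntegral_congr_fun .of_discrete fun π hπ => ?_
    simp only [Y, descSign_eq_of_mem_fixing h hca hπ, two_mul]
  rw [integral_mul_pairSign, hfix] at hdesc
  calc _ = |(∫ π, Y π * descSign a b π ∂μ - (∫ π in swapping a b, Y π ∂μ
          - 2 * ∫ π in fixing {a, b}, descSign b c π ∂μ)) + ∫ π in swapping a b, Y π ∂μ| := by
        congr 1
        ring
    _ ≤ _ := abs_add_le _ _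
    _ ≤ _ := add_le_add hdesc hswap
    _ = _ := by ring

lemma abs_integral_descSign_mul_descSign_adjacent_sub_le (hab : a ⋖ b) (hbc : b ⋖ c) :
    |∫ π, descSign a b π * descSign b c π ∂μ - (-1 / 3 + 4 / 3 * μ.real (fixing {a, b, c}))|
      ≤ 4 / ((Fintype.card α : ℝ) - 1) := by
  have hac : a < c := hab.lt.trans hbc.lt
  have hleft := abs_integral_add_mul_descSign_add_le (μ := μ) hab hac.ne' hbc.ne'
  have hright := abs_integral_add_mul_descSign_add_le (μ := μ) hbc hab.ne hac.ne
  have hfix := setIntegral_fixing_descSign_add (μ := μ) hac hbc hab.ne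
  simp only [descSign_comm hab.ne, descSign_comm hac.ne, Pi.neg_apply, add_mul, neg_mul,
    integral_neg, integral_add Integrable.of_finite Integrable.of_finite] at hleft hright
  have htriple : ∫ π, descSign a b π * descSign b c π ∂μ = -1
      + (∫ π, descSign a c π * descSign a b π ∂μ + ∫ π, descSign a c π * descSign b c π ∂μ) := by
    simp only [descSign_mul_descSign a b c, mul_add]
    rw [integral_add .of_finite .of_finite, integral_add .of_finite .of_finite]
    simp
  simp only [mul_comm (descSign b c _) (descSign a b _)] at hleft
  rw [abs_le] at *
  constructor
  · linear_combination (1 / 3) * hleft.1 + (1 / 3) * hright.2 - (1 / 3) * htriple + (2 / 3) * hfix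
  · linear_combination (1 / 3) * hleft.2 + (1 / 3) * hright.1 + (1 / 3) * htriple - (2 / 3) * hfix


variable {F : ℕ}

lemma abs_covariance_pairSign_sub_le (hF : ∀ᵐ π ∂μ, #π.supportᶜ = F) (hab : a ≠ b) (hca : c ≠ a)
    (hcb : c ≠ b) (hda : d ≠ a) (hdb : d ≠ b) (hdc : d ≠ c) :
    |cov[pairSign a b, pairSign c d; μ] - (fallingRatio F (Fintype.card α) 4
        - fallingRatio F (Fintype.card α) 2 ^ 2)|
      ≤ 11 / (((Fintype.card α : ℝ) - 1) * (Fintype.card α - 3)) := by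
  have hcard4 : #{a, b, c, d} = 4 := by
    simp [card_insert_of_notMem, *, Ne.symm]
  have hinter : fixing {a, b} ∩ fixing {c, d} = fixing {a, b, c, d} := by
    ext π
    simp [fixing, and_assoc]
  have hfix : cov[(fixing {a, b}).indicator 1, (fixing {c, d}).indicator 1; μ]
      = fallingRatio F (Fintype.card α) 4 - fallingRatio F (Fintype.card α) 2 ^ 2 := by
    rw [covariance_indicator_one .of_discrete .of_discrete, hinter, measureReal_fixing hF,
      measureReal_fixing hF, measureReal_fixing hF, hcard4, card_pair hab, card_pair hdc.symm, sq]
  have hsplit : cov[pairSign a b, pairSign c d; μ]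
      = cov[(swapping a b).indicator 1, (swapping c d).indicator 1; μ]
        - cov[(swapping a b).indicator 1, (fixing {c, d}).indicator 1; μ]
        - cov[(swapping c d).indicator 1, (fixing {a, b}).indicator 1; μ]
        + cov[(fixing {a, b}).indicator 1, (fixing {c, d}).indicator 1; μ] := by
    rw [covariance_comm ((swapping c d).indicator 1)]
    exact covariance_sub_sub .of_discrete .of_discrete .of_discrete .of_discrete
  have hss := abs_le.1 (abs_covariance_swapping_swapping_le (μ := μ) hab hca hcb hda hdb hdc)
  have hsf := abs_le.1 (abs_covariance_swapping_fixing_le hF hab hca hcb hda hdb hdc)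
  have hfs := abs_le.1 (abs_covariance_swapping_fixing_le hF hdc.symm hca.symm hda.symm hcb.symm
    hdb.symm hab.symm)
  rw [hsplit, hfix, abs_le]
  constructor
  · linear_combination hss.1 + hsf.2 + hfs.2
  · linear_combination hss.2 + hsf.1 + hfs.1

lemma abs_covariance_descSign_sub_le (hF : ∀ᵐ π ∂μ, #π.supportᶜ = F) (hab : a ⋖ b) (hcd : c ⋖ d)
    (hca : c ≠ a) (hcb : c ≠ b) (hda : d ≠ a) (hdb : d ≠ b) :
    |cov[descSign a b, descSign c d; μ] - (fallingRatio F (Fintype.card α) 4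
        - fallingRatio F (Fintype.card α) 2 ^ 2)|
      ≤ 13 / (((Fintype.card α : ℝ) - 1) * (Fintype.card α - 3)) := by
  have hcov : cov[descSign a b, descSign c d; μ] - cov[pairSign a b, pairSign c d; μ]
      = ∫ π, descSign a b π * descSign c d π ∂μ - ∫ π, pairSign a b π * pairSign c d π ∂μ := by
    rw [covariance_eq_sub .of_discrete .of_discrete, covariance_eq_sub .of_discrete .of_discrete,
      integral_descSign_eq_integral_pairSign hab, integral_descSign_eq_integral_pairSign hcd]
    simp only [Pi.mul_apply, sub_sub_sub_cancel_right]
  have hdesc := abs_integral_descSign_mul_descSign_sub_le (μ := μ) hab hcd hca hcb hda hdb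
  rw [← hcov] at hdesc
  calc _ ≤ _ := abs_sub_le _ (cov[pairSign a b, pairSign c d; μ]) _
    _ ≤ _ := add_le_add hdesc (abs_covariance_pairSign_sub_le hF hab.ne hca hcb hda hdb hcd.ne')
    _ = _ := by ring

lemma abs_integral_descSign_mul_integral_descSign_sub_le (hF : ∀ᵐ π ∂μ, #π.supportᶜ = F)
    (hab : a ⋖ b) (hcd : c ⋖ d) :
    |(∫ π, descSign a b π ∂μ) * ∫ π, descSign c d π ∂μ - fallingRatio F (Fintype.card α) 2 ^ 2|
      ≤ 2 / ((Fintype.card α : ℝ) - 1) := by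
  have hswap := measureReal_swapping_le (μ := μ) hab.ne
  have hswap' := measureReal_swapping_le (μ := μ) hcd.ne
  have hfix : μ.real (fixing {a, b}) = fallingRatio F (Fintype.card α) 2 := by
    rw [measureReal_fixing hF, card_pair hab.ne]
  have hfix' : μ.real (fixing {c, d}) = fallingRatio F (Fintype.card α) 2 := by
    rw [measureReal_fixing hF, card_pair hcd.ne]
  have hr0 : 0 ≤ fallingRatio F (Fintype.card α) 2 := hfix ▸ measureReal_nonneg
  have hr1 : fallingRatio F (Fintype.card α) 2 ≤ 1 := hfix ▸ measureReal_le_one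
  rw [integral_descSign hab, integral_descSign hcd, hfix, hfix']
  generalize fallingRatio F (Fintype.card α) 2 = r at hr0 hr1
  calc |(μ.real (swapping a b) - r) * (μ.real (swapping c d) - r) - r ^ 2|
      = |μ.real (swapping a b) * μ.real (swapping c d)
          - r * (μ.real (swapping a b) + μ.real (swapping c d))| := by
        congr 1
        ring
    _ ≤ μ.real (swapping a b) + μ.real (swapping c d) := by
        refine abs_sub_le_of_nonneg_of_le (by positivity) ?_ (by positivity) ?_
        · exact (mul_le_of_le_one_right measureReal_nonneg measureReal_le_one).trans
            (le_add_of_nonneg_right measureReal_nonneg)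
        · exact mul_le_of_le_one_left (by positivity) hr1
    _ ≤ 2 / ((Fintype.card α : ℝ) - 1) := by linear_combination hswap + hswap'

lemma abs_covariance_descSign_adjacent_sub_le (hF : ∀ᵐ π ∂μ, #π.supportᶜ = F) (hab : a ⋖ b)
    (hbc : b ⋖ c) :
    |cov[descSign a b, descSign b c; μ] - (-1 / 3 + 4 / 3 * fallingRatio F (Fintype.card α) 3
        - fallingRatio F (Fintype.card α) 2 ^ 2)|
      ≤ 6 / ((Fintype.card α : ℝ) - 1) := by
  have hcard3 : #{a, b, c} = 3 :=
    card_eq_three.2 ⟨a, b, c, hab.ne, (hab.lt.trans hbc.lt).ne, hbc.ne, rfl⟩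
  have hmul := abs_integral_descSign_mul_descSign_adjacent_sub_le (μ := μ) hab hbc
  rw [measureReal_fixing hF, hcard3] at hmul
  rw [covariance_eq_sub .of_discrete .of_discrete, sub_sub_sub_comm]
  calc _ ≤ _ := abs_sub _ _
    _ ≤ _ := add_le_add hmul (abs_integral_descSign_mul_integral_descSign_sub_le hF hab hbc)
    _ = _ := by ring

lemma abs_covariance_descSign_self_sub_le (hF : ∀ᵐ π ∂μ, #π.supportᶜ = F) (hab : a ⋖ b) :
    |cov[descSign a b, descSign a b; μ] - (1 - fallingRatio F (Fintype.card α) 2 ^ 2)|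
      ≤ 2 / ((Fintype.card α : ℝ) - 1) := by
  have hsq : descSign a b * descSign a b = 1 := by
    ext π
    rw [Pi.mul_apply, ← abs_mul_abs_self, abs_descSign, mul_one, Pi.one_apply]
  rw [covariance_eq_sub .of_discrete .of_discrete, hsq, abs_sub_comm, sub_sub_sub_comm]
  simpa using abs_integral_descSign_mul_integral_descSign_sub_le hF hab hab

end Correlation

/-! ### The variance of the number of descents -/

section Variance

/-- The entry at position `(i, j)` of the matrix which is `V` on the diagonal, `B` next to it, and
`A` elsewhere. -/
def bandEntry (V B A : ℝ) (i j : ℕ) : ℝ :=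
  if i = j then V else if i = j + 1 ∨ j = i + 1 then B else A

lemma bandEntry_comm (V B A : ℝ) (i j : ℕ) : bandEntry V B A i j = bandEntry V B A j i := by
  simp only [bandEntry, eq_comm (a := i) (b := j), or_comm]

lemma bandEntry_self (V B A : ℝ) (i : ℕ) : bandEntry V B A i i = V := if_pos rfl

lemma bandEntry_add_one (V B A : ℝ) (i : ℕ) : bandEntry V B A i (i + 1) = B := by
  simp [bandEntry]

lemma bandEntry_of_add_one_lt (V B A : ℝ) {i j : ℕ} (h : i + 1 < j) : bandEntry V B A i j = A := by
  rw [bandEntry, if_neg (by omega), if_neg (by omega)]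

lemma sum_bandEntry_last (V B A : ℝ) (m : ℕ) :
    ∑ i : Fin (m + 1), bandEntry V B A i (m + 1) = m * A + B := by
  have hfar (i : Fin m) : bandEntry V B A i (m + 1) = A :=
    bandEntry_of_add_one_lt V B A (Nat.succ_lt_succ i.isLt)
  simp only [Fin.sum_univ_castSucc, Fin.val_castSucc, Fin.val_last, hfar, bandEntry_add_one,
    sum_const, card_univ, Fintype.card_fin, nsmul_eq_mul]

lemma sum_sum_bandEntry (V B A : ℝ) (m : ℕ) :
    ∑ i : Fin (m + 1), ∑ j : Fin (m + 1), bandEntry V B A i j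
      = (m + 1) * V + 2 * m * B + m * (m - 1) * A := by
  induction m with
  | zero => simp [bandEntry]
  | succ m ih =>
    have hcol := sum_bandEntry_last V B A m
    have hrow : ∑ j : Fin (m + 1), bandEntry V B A (m + 1) j = m * A + B := by
      simpa only [bandEntry_comm V B A (m + 1)] using hcol
    simp only [Fin.sum_univ_castSucc (n := m + 1), sum_add_distrib, Fin.val_castSucc, Fin.val_last,
      ih, hcol, hrow, bandEntry_self]
    push_cast
    ring

lemma abs_sum_sum_sub_sum_sum_bandEntry_le {m : ℕ} {g : Fin m → Fin m → ℝ} {V B A v b a : ℝ}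
    (hg : ∀ i j : Fin m, |g i j - bandEntry V B A i j| ≤ bandEntry v b a i j) :
    |∑ i, ∑ j, g i j - ∑ i : Fin m, ∑ j : Fin m, bandEntry V B A i j|
      ≤ ∑ i : Fin m, ∑ j : Fin m, bandEntry v b a i j := by
  simp only [← sum_sub_distrib]
  exact (abs_sum_le_sum_abs _ _).trans <| sum_le_sum fun i _ =>
    (abs_sum_le_sum_abs _ _).trans <| sum_le_sum fun j _ => hg i j

/-- The variance of the sum of the descent signs, up to a bounded error: `n - 1` variances,
`2 (n - 2)` covariances of overlapping pairs of adjacent positions and `(n - 2) (n - 3)`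
covariances of disjoint ones. -/
noncomputable def leadingVariance (F n : ℕ) : ℝ :=
  (n - 1) * (1 - fallingRatio F n 2 ^ 2)
    + 2 * (n - 2) * (-1 / 3 + 4 / 3 * fallingRatio F n 3 - fallingRatio F n 2 ^ 2)
    + (n - 2) * (n - 3) * (fallingRatio F n 4 - fallingRatio F n 2 ^ 2)

lemma castSucc_covBy_succ {m : ℕ} (i : Fin m) : i.castSucc ⋖ i.succ :=
  Fin.covBy_iff.2 (Order.covBy_succ (i : ℕ))

lemma descentNumber_eq_sum_descSign {m : ℕ} (π : Perm (Fin (m + 1))) :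
    (descentNumber π : ℝ) = 1 / 2 * ∑ i : Fin m, descSign i.castSucc i.succ π + m / 2 := by
  have hsign (i : Fin m) : (if π i.succ < π i.castSucc then (1 : ℝ) else 0)
      = 1 / 2 * descSign i.castSucc i.succ π + 1 / 2 := by
    unfold descSign
    split_ifs <;> norm_num
  have hsum : (descentNumber π : ℝ)
      = ∑ i : Fin m, if π i.succ < π i.castSucc then (1 : ℝ) else 0 := by
    rw [descentNumber, descentSet, natCast_card_filter, Fin.sum_univ_castSucc, if_neg (by simp),
      add_zero]
    exact sum_congr rfl fun i _ => if_congr ⟨fun ⟨_, h⟩ => h, fun h => ⟨by simp, h⟩⟩ rfl rfl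
  simp only [hsum, hsign, sum_add_distrib, ← mul_sum, sum_const, card_univ, Fintype.card_fin,
    nsmul_eq_mul, mul_one_div]

variable {m : ℕ} [MeasurableSpace (Perm (Fin (m + 1)))]
  [DiscreteMeasurableSpace (Perm (Fin (m + 1)))] {μ : Measure (Perm (Fin (m + 1)))}
  [IsProbabilityMeasure μ]

lemma four_mul_variance_descentNumber :
    4 * Var[fun π => (descentNumber π : ℝ); μ] = ∑ i : Fin m, ∑ j : Fin m,
      cov[descSign i.castSucc i.succ, descSign j.castSucc j.succ; μ] := by
  simp only [descentNumber_eq_sum_descSign]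
  rw [variance_add_const .of_discrete, variance_const_mul, variance_fun_sum fun _ => .of_discrete]
  ring

variable [SMulInvariantMeasure (ConjAct (Perm (Fin (m + 1)))) (Perm (Fin (m + 1))) μ] {F : ℕ}

lemma abs_covariance_descSign_sub_bandEntry_le (hF : ∀ᵐ π ∂μ, #π.supportᶜ = F) (i j : Fin m) :
    |cov[descSign i.castSucc i.succ, descSign j.castSucc j.succ; μ]
      - bandEntry (1 - fallingRatio F (m + 1) 2 ^ 2)
          (-1 / 3 + 4 / 3 * fallingRatio F (m + 1) 3 - fallingRatio F (m + 1) 2 ^ 2)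
          (fallingRatio F (m + 1) 4 - fallingRatio F (m + 1) 2 ^ 2) i j|
      ≤ bandEntry (2 / m) (6 / m) (13 / (m * (m - 2))) i j := by
  wlog hij : i ≤ j generalizing i j
  · rw [covariance_comm, bandEntry_comm, bandEntry_comm (2 / m)]
    exact this j i (le_of_not_ge hij)
  have hm₁ : ((Fintype.card (Fin (m + 1)) : ℕ) : ℝ) - 1 = m := by simp
  have hm₃ : ((Fintype.card (Fin (m + 1)) : ℕ) : ℝ) - 3 = m - 2 := by
    rw [← hm₁]
    ring
  have hi := castSucc_covBy_succ i
  have hj := castSucc_covBy_succ j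
  rcases hij.eq_or_lt with rfl | hlt
  · have hself := abs_covariance_descSign_self_sub_le hF hi
    rw [hm₁, Fintype.card_fin] at hself
    rwa [bandEntry_self, bandEntry_self]
  rcases (Fin.lt_def.1 hlt).nat_succ_le.eq_or_lt with hadj | hfar
  · have hsucc : i.succ = j.castSucc := Fin.ext hadj
    have hadjacent := abs_covariance_descSign_adjacent_sub_le hF hi (hsucc ▸ hj)
    rw [hm₁, Fintype.card_fin] at hadjacent
    rwa [← hadj, ← hsucc, Nat.succ_eq_add_one, bandEntry_add_one, bandEntry_add_one]
  · have hsep : i.succ < j.castSucc := hfar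
    have hdistant := abs_covariance_descSign_sub_le hF hi hj (hi.lt.trans hsep).ne' hsep.ne'
      (hi.lt.trans (hsep.trans hj.lt)).ne' (hsep.trans hj.lt).ne'
    rw [hm₁, hm₃, Fintype.card_fin] at hdistant
    rwa [bandEntry_of_add_one_lt _ _ _ hfar, bandEntry_of_add_one_lt _ _ _ hfar]

end Variance

lemma abs_four_mul_variance_descentNumber_sub_le {n F : ℕ} (hn : 4 ≤ n)
    [MeasurableSpace (Perm (Fin n))] [DiscreteMeasurableSpace (Perm (Fin n))]
    {μ : Measure (Perm (Fin n))} [IsProbabilityMeasure μ]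
    [SMulInvariantMeasure (ConjAct (Perm (Fin n))) (Perm (Fin n)) μ]
    (hF : ∀ᵐ π ∂μ, #π.supportᶜ = F) :
    |4 * Var[fun π => (descentNumber π : ℝ); μ] - leadingVariance F n| ≤ 27 := by
  obtain ⟨k, rfl⟩ := Nat.exists_eq_add_of_le' hn
  have h := abs_sum_sum_sub_sum_sum_bandEntry_le (abs_covariance_descSign_sub_bandEntry_le hF)
  rw [← four_mul_variance_descentNumber, sum_sum_bandEntry _ _ _ (k + 2),
    sum_sum_bandEntry _ _ _ (k + 2)] at h
  have hleading : leadingVariance F (k + 4)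
      = ((k + 2 : ℕ) + 1) * (1 - fallingRatio F (k + 4) 2 ^ 2)
        + 2 * (k + 2 : ℕ) * (-1 / 3 + 4 / 3 * fallingRatio F (k + 4) 3
          - fallingRatio F (k + 4) 2 ^ 2)
        + (k + 2 : ℕ) * ((k + 2 : ℕ) - 1) * (fallingRatio F (k + 4) 4
          - fallingRatio F (k + 4) 2 ^ 2) := by
    unfold leadingVariance
    push_cast
    ring
  rw [hleading]
  refine h.trans ?_
  have hk : (k : ℝ) + 3 - 2 = k + 1 := by ring
  push_cast
  rw [hk]
  field_simp
  linarith


/-! ### Asymptotics -/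

section Asymptotics

open Filter Topology

lemma fallingRatio_zero (F n : ℕ) : fallingRatio F n 0 = 1 := by
  simp [fallingRatio]

lemma cast_descFactorial_succ (n k : ℕ) :
    (n.descFactorial (k + 1) : ℝ) = (n - k) * n.descFactorial k := by
  rcases le_or_gt k n with h | h
  · rw [Nat.descFactorial_succ, Nat.cast_mul, Nat.cast_sub h]
  · simp [Nat.descFactorial_succ, Nat.descFactorial_of_lt h]

lemma fallingRatio_succ (F n k : ℕ) :
    fallingRatio F n (k + 1) = (F - k) / (n - k) * fallingRatio F n k := by
  simp only [fallingRatio, cast_descFactorial_succ, mul_div_mul_comm]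

variable {ι : Type*} {l : Filter ι} {n F : ι → ℕ} {α : ℝ}

lemma tendsto_fallingRatio (hn : Tendsto n l atTop)
    (hα : Tendsto (fun i => (F i : ℝ) / n i) l (𝓝 α)) (k : ℕ) :
    Tendsto (fun i => fallingRatio (F i) (n i) k) l (𝓝 (α ^ k)) := by
  induction k with
  | zero => simpa only [fallingRatio_zero, pow_zero] using tendsto_const_nhds
  | succ k ih =>
    have hnR : Tendsto (fun i => (n i : ℝ)) l atTop := tendsto_natCast_atTop_atTop.comp hn
    have hk : Tendsto (fun i => (k : ℝ) / n i) l (𝓝 0) := hnR.const_div_atTop _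
    have hfactor : Tendsto (fun i => ((F i : ℝ) - k) / (n i - k)) l (𝓝 α) := by
      have h := (hα.sub hk).div (tendsto_const_nhds.sub hk) (b := (1 : ℝ) - 0) (by norm_num)
      rw [sub_zero, sub_zero, div_one] at h
      refine h.congr' ?_
      filter_upwards [hnR.eventually_gt_atTop 0] with i hi
      rw [Pi.div_apply, ← sub_div, ← div_self hi.ne', ← sub_div, div_div_div_cancel_right₀ hi.ne']
    simpa only [fallingRatio_succ, pow_succ'] using hfactor.mul ih

lemma mul_fallingRatio_four_sub_sq_div {F n : ℕ} (hn : 4 ≤ n) {f u : ℝ} (hf : f = F / n)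
    (hu : u = 1 / n) :
    ((n : ℝ) - 2) * (n - 3) * (fallingRatio F n 4 - fallingRatio F n 2 ^ 2) / n
      = fallingRatio F n 2
        * ((-4 * f + 4 * f ^ 2 + 6 * u * (1 - u - f ^ 2 + f * u)) / (1 - u)) := by
  have hn4 : (4 : ℝ) ≤ n := by exact_mod_cast hn
  have h₀ : (n : ℝ) ≠ 0 := by linarith
  have h₁ : (n : ℝ) - 1 ≠ 0 := by linarith
  have h₂ : (n : ℝ) - 2 ≠ 0 := by linarith
  have h₃ : (n : ℝ) - 3 ≠ 0 := by linarith
  have hu₁ : 1 - u = (n - 1) / n := by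
    rw [hu]
    field_simp
  rw [hu₁, hu, hf]
  simp only [fallingRatio_succ, fallingRatio_zero, Nat.cast_zero, Nat.cast_one, Nat.cast_ofNat]
  field_simp
  ring

lemma tendsto_mul_fallingRatio_four_sub_sq_div (hn : Tendsto n l atTop)
    (hα : Tendsto (fun i => (F i : ℝ) / n i) l (𝓝 α)) :
    Tendsto (fun i => ((n i : ℝ) - 2) * (n i - 3)
      * (fallingRatio (F i) (n i) 4 - fallingRatio (F i) (n i) 2 ^ 2) / n i) l
      (𝓝 (α ^ 2 * (-4 * α + 4 * α ^ 2))) := by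
  have hu : Tendsto (fun i => 1 / (n i : ℝ)) l (𝓝 0) :=
    (tendsto_natCast_atTop_atTop.comp hn).const_div_atTop _
  have hcont : ContinuousAt (fun x : ℝ × ℝ => (-4 * x.1 + 4 * x.1 ^ 2
      + 6 * x.2 * (1 - x.2 - x.1 ^ 2 + x.1 * x.2)) / (1 - x.2)) (α, 0) := by
    fun_prop (disch := norm_num)
  have h := (tendsto_fallingRatio hn hα 2).mul (hcont.tendsto.comp (hα.prodMk_nhds hu))
  simp only [mul_zero, zero_mul, add_zero, sub_zero, div_one] at h
  refine h.congr' ?_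
  filter_upwards [hn.eventually_ge_atTop 4] with i hi
  exact (mul_fallingRatio_four_sub_sq_div hi rfl rfl).symm

lemma tendsto_leadingVariance_div (hn : Tendsto n l atTop)
    (hα : Tendsto (fun i => (F i : ℝ) / n i) l (𝓝 α)) :
    Tendsto (fun i => leadingVariance (F i) (n i) / n i) l
      (𝓝 ((1 - 4 * α ^ 3 + 3 * α ^ 4) / 3)) := by
  have hnR : Tendsto (fun i => (n i : ℝ)) l atTop := tendsto_natCast_atTop_atTop.comp hn
  have hsub (c : ℝ) : Tendsto (fun i => ((n i : ℝ) - c) / n i) l (𝓝 1) := by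
    have h := (tendsto_const_nhds (x := (1 : ℝ))).sub (hnR.const_div_atTop c)
    rw [sub_zero] at h
    refine h.congr' ?_
    filter_upwards [hnR.eventually_gt_atTop 0] with i hi
    rw [sub_div, div_self hi.ne']
  have hr := tendsto_fallingRatio hn hα
  have h := ((hsub 1).mul (((hr 2).pow 2).const_sub 1)).add
    (((hsub 2).const_mul 2).mul
      ((((hr 3).const_mul (4 / 3)).const_add (-1 / 3)).sub ((hr 2).pow 2)))
    |>.add (tendsto_mul_fallingRatio_four_sub_sq_div hn hα)
  refine (h.congr fun i => ?_).trans_eq (congrArg 𝓝 ?_)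
  · rw [leadingVariance]
    ring
  · ring

lemma isEquivalent_const_mul_of_tendsto_div {v x : ι → ℝ} {c : ℝ} (hc : c ≠ 0)
    (h : Tendsto (fun i => v i / x i) l (𝓝 c)) :
    Asymptotics.IsEquivalent l v fun i => c * x i := by
  refine Asymptotics.isEquivalent_of_tendsto_one ?_
  have h' := h.div_const c
  rw [div_self hc] at h'
  refine h'.congr fun i => ?_
  rw [Pi.div_apply, div_div, mul_comm]

lemma one_sub_four_mul_pow_add_pos {x : ℝ} (hx : x < 1) : 0 < 1 - 4 * x ^ 3 + 3 * x ^ 4 := by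
  have hfactor : 1 - 4 * x ^ 3 + 3 * x ^ 4 = (1 - x) ^ 2 * ((1 + x) ^ 2 + 2 * x ^ 2) := by ring
  have hquad : 0 < (1 + x) ^ 2 + 2 * x ^ 2 := by nlinarith [sq_nonneg (1 + 3 * x)]
  rw [hfactor]
  exact mul_pos (sq_pos_of_pos (sub_pos.2 hx)) hquad

variable [∀ i, MeasurableSpace (Perm (Fin (n i)))] [∀ i, DiscreteMeasurableSpace (Perm (Fin (n i)))]
  {μ : ∀ i, Measure (Perm (Fin (n i)))} [∀ i, IsProbabilityMeasure (μ i)]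
  [∀ i, SMulInvariantMeasure (ConjAct (Perm (Fin (n i)))) (Perm (Fin (n i))) (μ i)]

lemma tendsto_variance_descentNumber_div (hF : ∀ i, ∀ᵐ π ∂μ i, #π.supportᶜ = F i)
    (hn : Tendsto n l atTop) (hα : Tendsto (fun i => (F i : ℝ) / n i) l (𝓝 α)) :
    Tendsto (fun i => Var[fun π => (descentNumber π : ℝ); μ i] / n i) l
      (𝓝 ((1 - 4 * α ^ 3 + 3 * α ^ 4) / 12)) := by
  have hnR : Tendsto (fun i => (n i : ℝ)) l atTop := tendsto_natCast_atTop_atTop.comp hn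
  have hdiff : Tendsto (fun i => (4 * Var[fun π => (descentNumber π : ℝ); μ i]
      - leadingVariance (F i) (n i)) / n i) l (𝓝 0) := by
    refine squeeze_zero_norm' ?_ (hnR.const_div_atTop 27)
    filter_upwards [hn.eventually_ge_atTop 4] with i hi
    rw [norm_div, Real.norm_natCast]
    gcongr
    exact abs_four_mul_variance_descentNumber_sub_le hi (hF i)
  have h := (hdiff.add (tendsto_leadingVariance_div hn hα)).div_const 4
  refine (h.congr fun i => ?_).trans_eq (congrArg 𝓝 ?_) <;> ring

end Asymptotics

/-! ### Uniform measures on conjugacy classes -/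

section CycleClass

lemma smulInvariantMeasure_uniformOn {G Ω : Type*} [Group G] [MulAction G Ω] [MeasurableSpace Ω]
    [DiscreteMeasurableSpace Ω] {s : Set Ω} (hs : ∀ (g : G) (x : Ω), g • x ∈ s ↔ x ∈ s) :
    SMulInvariantMeasure G Ω (uniformOn s) where
  measure_preimage_smul g t _ := by
    have hpre : s ∩ (g • ·) ⁻¹' t = (g • ·) ⁻¹' (s ∩ t) := by
      ext x
      simp [hs]
    rw [uniformOn, cond_apply .of_discrete, cond_apply .of_discrete, hpre,
      Set.preimage_smul, ← Set.image_smul,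
      Measure.count_injective_image (MulAction.injective g⁻¹)]

variable {n : ℕ} (p : n.Partition)

lemma parts_eq_filter_add_replicate :
    p.parts = p.parts.filter (2 ≤ ·) + Multiset.replicate (partMult p 1) 1 := by
  have hones : p.parts.filter (¬2 ≤ ·) = Multiset.replicate (partMult p 1) 1 := by
    rw [partMult, ← Multiset.filter_eq']
    refine Multiset.filter_congr fun k hk => ?_
    have := p.parts_pos hk
    omega
  rw [← hones, Multiset.filter_add_not]

lemma cycleClass_nonempty : (cycleClass p).Nonempty := by
  have hparts := parts_eq_filter_add_replicate p
  have hsum : (p.parts.filter (2 ≤ ·)).sum + partMult p 1 = n := by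
    simpa [p.parts_sum] using (congrArg Multiset.sum hparts).symm
  obtain ⟨π, hπ⟩ := (Perm.exists_with_cycleType_iff (Fin n) (m := p.parts.filter (2 ≤ ·))).2
    ⟨by rw [Fintype.card_fin]; omega, by simp⟩
  refine ⟨π, (mem_filter_univ π).2 ?_⟩
  rw [Perm.parts_partition, ← Perm.sum_cycleType, hπ, Fintype.card_fin,
    Nat.sub_eq_of_eq_add' hsum.symm, ← hparts]

variable {p}

lemma conj_mem_cycleClass_iff (σ π : Perm (Fin n)) :
    σ * π * σ⁻¹ ∈ cycleClass p ↔ π ∈ cycleClass p := by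
  have hconj : IsConj π (σ * π * σ⁻¹) := isConj_iff.2 ⟨σ, rfl⟩
  simp only [cycleClass, mem_filter_univ, Perm.partition_eq_of_isConj.1 hconj]

lemma card_compl_support_of_mem_cycleClass {π : Perm (Fin n)} (hπ : π ∈ cycleClass p) :
    #π.supportᶜ = partMult p 1 := by
  have hone : 1 ∉ π.cycleType := fun h => absurd (Perm.two_le_of_mem_cycleType h) (by norm_num)
  rw [partMult, ← (mem_filter_univ π).1 hπ, Perm.parts_partition, Multiset.count_add,
    Multiset.count_eq_zero_of_notMem hone, Multiset.count_replicate_self, zero_add, card_compl]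

variable [MeasurableSpace (Perm (Fin n))] [DiscreteMeasurableSpace (Perm (Fin n))]

instance : IsProbabilityMeasure (uniformOn (cycleClass p : Set (Perm (Fin n)))) :=
  isProbabilityMeasure_uniformOn (Set.toFinite _) (cycleClass_nonempty p)

instance : SMulInvariantMeasure (ConjAct (Perm (Fin n))) (Perm (Fin n))
    (uniformOn (cycleClass p : Set (Perm (Fin n)))) :=
  smulInvariantMeasure_uniformOn fun σ π => conj_mem_cycleClass_iff (ConjAct.ofConjAct σ) π

variable (p)

lemma ae_uniformOn_cycleClass_card_compl_support :
    ∀ᵐ π ∂uniformOn (cycleClass p : Set (Perm (Fin n))), #π.supportᶜ = partMult p 1 :=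
  (ae_cond_mem .of_discrete).mono fun _ hπ => card_compl_support_of_mem_cycleClass hπ

end CycleClass

theorem mainTheorem4_general {ι : Type*} {l : Filter ι} {n F : ι → ℕ} {α : ℝ}
    [∀ k, MeasurableSpace (Perm (Fin (n k)))] [∀ k, DiscreteMeasurableSpace (Perm (Fin (n k)))]
    {μ : ∀ k, Measure (Perm (Fin (n k)))} [∀ k, IsProbabilityMeasure (μ k)]
    [∀ k, SMulInvariantMeasure (ConjAct (Perm (Fin (n k)))) (Perm (Fin (n k))) (μ k)]
    (hF : ∀ k, ∀ᵐ π ∂μ k, #π.supportᶜ = F k) (hn : Filter.Tendsto n l Filter.atTop)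
    (hα : Filter.Tendsto (fun k => (F k : ℝ) / (n k : ℝ)) l (nhds α)) :
    Filter.Tendsto (fun k => Var[fun π => (descentNumber π : ℝ); μ k] / (n k : ℝ)) l
        (nhds ((1 - 4 * α ^ 3 + 3 * α ^ 4) / 12)) ∧
      (α < 1 → Asymptotics.IsEquivalent l (fun k => Var[fun π => (descentNumber π : ℝ); μ k])
        (fun k => (1 - 4 * α ^ 3 + 3 * α ^ 4) * ((n k : ℝ) / 12))) := by
  have hlim := tendsto_variance_descentNumber_div hF hn hα
  refine ⟨hlim, fun hα₁ => ?_⟩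
  have hpos := one_sub_four_mul_pow_add_pos hα₁
  simpa only [div_mul_eq_mul_div, mul_div_assoc] using
    isEquivalent_const_mul_of_tendsto_div (by positivity) hlim

theorem mainTheorem4 {ι : Type*} (l : Filter ι) (n : ι → ℕ) (p : ∀ k, (n k).Partition) (α : ℝ)
    (hn : Filter.Tendsto n l Filter.atTop)
    (hα : Filter.Tendsto (fun k => (partMult (p k) 1 : ℝ) / (n k : ℝ)) l (nhds α)) :
    Filter.Tendsto (fun k => descentVariance (p k) / (n k : ℝ)) l
        (nhds ((1 - 4 * α ^ 3 + 3 * α ^ 4) / 12)) ∧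
      (α < 1 → Asymptotics.IsEquivalent l (fun k => descentVariance (p k))
        (fun k => (1 - 4 * α ^ 3 + 3 * α ^ 4) * ((n k : ℝ) / 12))) := by
  let _ (k : ι) : MeasurableSpace (Perm (Fin (n k))) := ⊤
  exact mainTheorem4_general (fun k => ae_uniformOn_cycleClass_card_compl_support (p k)) hn hα
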